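/- For a group $G$ and an integer $d\ge 0$, let $\operatorname{LSP}_d(G)\in\{0,1,2,\dots\}\cup\{\infty\}$ be the infimum (with $\inf\varnothing=\infty$) of all integers $m\ge 0$ such that for every finite subset $L\subseteq G$ there is a finite subset $M\subseteq G$ with $e\in M=M^{-1}$ satisfying: for any $n>m$ and any $g_1,\dots,g_n\in ML$ there is a subset $F\subseteq\{1,\dots,n\}$ with $|F|>d+1$ and $g_ig_j^{-1}\in M$ for all $i,j\in F$. For a finite generating set $S$ of $G$ and an integer $n\ge 0$, let $\operatorname{Gr}_{G,S}(n)$ be the number of elements of $G$ that are products of at most $n$ elements of $S\cup S^{-1}$. Let $G$ be a finitely generated virtually nilpotent group. Then $\operatorname{LSP}_d(G)<\infty$ for every integer $d\ge 0$. Explicitly, let $S$ be any finite generating set of $G$. Then there are an integer $k\ge 0$ and real numbers $0<C\le D$ such that, with the convention $0^0=1$, $$C n^k\le \operatorname{Gr}_{G,S}(n)\le D n^k+1\qquad\text{for all } n\in\{0,1,2,\dots\},$$ and for all such $k$, $C$, $D$ and every integer $d\ge 0$, $$\operatorname{LSP}_d(G)\le 3^k(d+1)\frac{D}{C}.$$ 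-/

import Mathlib

open scoped Pointwise ENNReal

/-- The condition on a nonnegative integer `m` in the definition of the `d`-dimensional large scale
packing constant of `G`: every finite `L ⊆ G` admits a finite symmetric `M ⊆ G` containing the
identity such that any list of more than `m` elements `g i` of `M * L` (repetitions allowed) has
more than `d + 1` indices for which all `g i * (g j)⁻¹` lie in `M`. -/
def IsPackingBound (d : ℕ) (G : Type*) [Group G] (m : ℕ) : Prop :=
  ∀ L : Set G, L.Finite →
    ∃ M : Set G, M.Finite ∧ M⁻¹ = M ∧ (1 : G) ∈ M ∧
      ∀ n : ℕ, m < n → ∀ g : Fin n → G, (∀ i, g i ∈ M * L) →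
        ∃ F : Finset (Fin n), d + 1 < F.card ∧ ∀ i ∈ F, ∀ j ∈ F, g i * (g j)⁻¹ ∈ M

/-- The `d`-dimensional large scale packing constant of `G`: the infimum of all `m` as above
(equal to `⊤` if there is none). -/
noncomputable def LSP (d : ℕ) (G : Type*) [Group G] : ℕ∞ :=
  ⨅ (m : ℕ) (_ : IsPackingBound d G m), (m : ℕ∞)

/-- The ball of radius `n` around the identity for the word length defined by `S`: the products of
at most `n` factors from `S ∪ S⁻¹`. -/
def wordBall {G : Type*} [Group G] (S : Set G) (n : ℕ) : Set G :=
  {g | ∃ l : List G, l.length ≤ n ∧ (∀ x ∈ l, x ∈ S ∨ x⁻¹ ∈ S) ∧ l.prod = g}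

/-- The growth function of `G` with regard to `S` (used for finite generating sets, for which
all the balls are finite). -/
noncomputable def growth {G : Type*} [Group G] (S : Set G) (n : ℕ) : ℕ :=
  (wordBall S n).ncard

/-! The packing bound is a pigeonhole argument on balls. If `L` lies in the ball `B(l)`, take `M =
B(2s)`. For `g i ∈ M * L` the translates `B(s) * g i` all lie in `B(3s+l)`, so if `n |B(s)| > (d+1)
|B(3s+l)|`, some point lies in more than `d+1` of them, and two translates that meet have `g i * (g
j)⁻¹ ∈ B(2s)`. The growth bounds make `|B(3s+l)| / |B(s)|` at most a quantity tending to `3^k D/C`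
as `s → ∞` when `k > 0`; for `k = 0` the group is finite.

The growth bounds come from iterated commutators in the generators, graded by weight; in a nilpotent
group those of large weight are trivial. A letter of weight `j` costs `n^(-j)`, so a word of length
`n` in the generators costs 1. Commutators are added to the alphabet one at a time, in descending
weight. Adding `x` of weight `i` leaves the degree unchanged if a positive power of `x` lies in the
group `H` already generated, and raises it by `i` otherwise. The upper bound collects `x` to the
right (`exists_collect`); the lower bound uses that, up to higher weight, `x^e` with `e ≤ n^i` has
length `O(n)` (`IteratedCommutator.exists_approx_pow`). Rewriting over coset representatives passes
to virtually nilpotent groups. -/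

open scoped commutatorElement

/-! ### Word balls and growth -/

section WordBall

variable {G : Type*} [Group G] {S : Set G}

theorem one_mem_wordBall (n : ℕ) : (1 : G) ∈ wordBall S n :=
  ⟨[], by simp, by simp, rfl⟩

theorem wordBall_mono {m n : ℕ} (h : m ≤ n) : wordBall S m ⊆ wordBall S n := by
  rintro g ⟨l, hl, hS, rfl⟩
  exact ⟨l, hl.trans h, hS, rfl⟩

theorem wordBall_mul_mem {m n : ℕ} {g h : G} (hg : g ∈ wordBall S m) (hh : h ∈ wordBall S n) :
    g * h ∈ wordBall S (m + n) := by
  obtain ⟨l, hl, hlS, rfl⟩ := hg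
  obtain ⟨l', hl', hlS', rfl⟩ := hh
  refine ⟨l ++ l', by simp; omega, fun x hx => ?_, by simp⟩
  rcases List.mem_append.1 hx with hx | hx
  · exact hlS x hx
  · exact hlS' x hx

theorem wordBall_inv_mem {n : ℕ} {g : G} (hg : g ∈ wordBall S n) : g⁻¹ ∈ wordBall S n := by
  obtain ⟨l, hl, hlS, rfl⟩ := hg
  refine ⟨(l.map (·⁻¹)).reverse, by simpa using hl, fun x hx => ?_, (List.prod_inv_reverse l).symm⟩
  simp only [List.mem_reverse, List.mem_map] at hx
  obtain ⟨y, hy, rfl⟩ := hx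
  simpa [or_comm] using hlS y hy

theorem mem_wordBall_one {x : G} (hx : x ∈ S ∨ x⁻¹ ∈ S) : x ∈ wordBall S 1 :=
  ⟨[x], by simp, by simpa using hx, by simp⟩

theorem pow_mem_wordBall {n : ℕ} {g : G} (hg : g ∈ wordBall S n) (e : ℕ) :
    g ^ e ∈ wordBall S (e * n) := by
  induction e with
  | zero => simpa using one_mem_wordBall 0
  | succ e ih => rw [pow_succ, Nat.succ_mul]; exact wordBall_mul_mem ih hg

theorem commutator_mem_wordBall {m n : ℕ} {g h : G} (hg : g ∈ wordBall S m)
    (hh : h ∈ wordBall S n) : ⁅g, h⁆ ∈ wordBall S (m + n + m + n) := by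
  rw [commutatorElement_def]
  exact wordBall_mul_mem (wordBall_mul_mem (wordBall_mul_mem hg hh) (wordBall_inv_mem hg))
    (wordBall_inv_mem hh)

theorem wordBall_succ_subset (n : ℕ) :
    wordBall S (n + 1) ⊆ wordBall S n * insert 1 (S ∪ S⁻¹) := by
  rintro g ⟨l, hl, hlS, rfl⟩
  rcases List.eq_nil_or_concat l with rfl | ⟨l', x, rfl⟩
  · exact ⟨1, one_mem_wordBall n, 1, by simp, by simp⟩
  · simp only [List.concat_eq_append, List.mem_append, List.length_append, List.length_singleton,
      List.mem_singleton] at hl hlS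
    refine ⟨l'.prod, ⟨l', by omega, fun y hy => hlS y (Or.inl hy), rfl⟩, x, ?_, by simp⟩
    exact Or.inr (by simpa using hlS x (Or.inr rfl))

theorem wordBall_zero : wordBall S 0 = {1} := by
  refine Set.Subset.antisymm ?_ (by simpa using one_mem_wordBall 0)
  rintro g ⟨l, hl, -, rfl⟩
  simp [List.length_eq_zero_iff.1 (Nat.le_zero.1 hl)]

theorem wordBall_finite (hS : S.Finite) (n : ℕ) : (wordBall S n).Finite := by
  induction n with
  | zero => simp [wordBall_zero]
  | succ n ih =>
    exact (ih.mul ((hS.union hS.inv).insert 1)).subset (wordBall_succ_subset n)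

theorem exists_list_of_mem_subgroupClosure {g : G} (hg : g ∈ Subgroup.closure S) :
    ∃ l : List G, (∀ x ∈ l, x ∈ S ∨ x⁻¹ ∈ S) ∧ l.prod = g := by
  rw [← Subgroup.mem_toSubmonoid, Subgroup.closure_toSubmonoid] at hg
  simpa using Submonoid.exists_list_of_mem_closure hg

theorem exists_mem_wordBall (hS : Subgroup.closure S = ⊤) (g : G) : ∃ n, g ∈ wordBall S n := by
  obtain ⟨l, hl, rfl⟩ := exists_list_of_mem_subgroupClosure (hS ▸ Subgroup.mem_top g)
  exact ⟨l.length, l, le_rfl, hl, rfl⟩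

theorem exists_subset_wordBall (hS : Subgroup.closure S = ⊤) {L : Set G} (hL : L.Finite) :
    ∃ n, L ⊆ wordBall S n := by
  induction L, hL using Set.Finite.induction_on with
  | empty => exact ⟨0, by simp⟩
  | @insert a L _ _ ih =>
    obtain ⟨n, hn⟩ := ih
    obtain ⟨m, hm⟩ := exists_mem_wordBall hS a
    refine ⟨max m n, Set.insert_subset (wordBall_mono (le_max_left _ _) hm)
      (hn.trans (wordBall_mono (le_max_right _ _)))⟩

theorem growth_mono (hS : S.Finite) {m n : ℕ} (h : m ≤ n) : growth S m ≤ growth S n :=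
  Set.ncard_le_ncard (wordBall_mono h) (wordBall_finite hS n)

theorem one_le_growth (hS : S.Finite) (n : ℕ) : 1 ≤ growth S n :=
  (Set.ncard_pos (wordBall_finite hS n)).2 ⟨1, one_mem_wordBall n⟩

end WordBall

/-! ### Iterated commutators, their weights and their distortion -/

section Commutators

variable {G : Type*} [Group G]

/-- The three subgroups lemma, applied in the quotient by `N`. -/
theorem Subgroup.commutator_commutator_le_of_rotate {A B C N : Subgroup G} [N.Normal]
    (h₁ : ⁅⁅B, C⁆, A⁆ ≤ N) (h₂ : ⁅⁅C, A⁆, B⁆ ≤ N) : ⁅⁅A, B⁆, C⁆ ≤ N := by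
  have key : ∀ {K : Subgroup G}, K ≤ N ↔ K.map (QuotientGroup.mk' N) = ⊥ := by
    intro K
    rw [Subgroup.map_eq_bot_iff, QuotientGroup.ker_mk']
  rw [key, Subgroup.map_commutator, Subgroup.map_commutator] at *
  exact Subgroup.commutator_commutator_eq_bot_of_rotate h₁ h₂

theorem Subgroup.commutator_lowerCentralSeries_le (i j : ℕ) :
    ⁅(⊤ : Subgroup G).lowerCentralSeries i, (⊤ : Subgroup G).lowerCentralSeries j⁆ ≤
      (⊤ : Subgroup G).lowerCentralSeries (i + j + 1) := by
  induction j generalizing i with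
  | zero => exact le_of_eq rfl
  | succ j ih =>
    rw [Subgroup.commutator_comm, Subgroup.lowerCentralSeries_succ]
    refine Subgroup.commutator_commutator_le_of_rotate ?_ ?_
    · rw [Subgroup.commutator_comm ⊤, ← Subgroup.lowerCentralSeries_succ]
      exact (ih (i + 1)).trans (le_of_eq (by congr 1; omega))
    · refine (Subgroup.commutator_mono (ih i) le_rfl).trans (le_of_eq ?_)
      rw [← Subgroup.lowerCentralSeries_succ]; congr 1

/-- The iterated commutators in the elements of `S` and their inverses, graded by the number of
entries. -/
inductive IteratedCommutator (S : Set G) : ℕ → G → Prop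
  | base {x : G} : x ∈ S ∨ x⁻¹ ∈ S → IteratedCommutator S 1 x
  | comm {i j : ℕ} {x y : G} : IteratedCommutator S i x → IteratedCommutator S j y →
      IteratedCommutator S (i + j) ⁅x, y⁆

namespace IteratedCommutator

variable {S : Set G} {i j : ℕ} {x y : G}

theorem inv (h : IteratedCommutator S i x) : IteratedCommutator S i x⁻¹ := by
  cases h with
  | base h => exact .base (by simpa [or_comm] using h)
  | comm h₁ h₂ => rw [commutatorElement_inv, add_comm]; exact h₂.comm h₁

theorem one_le (h : IteratedCommutator S i x) : 1 ≤ i := by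
  induction h with
  | base => exact le_rfl
  | comm _ _ h₁ h₂ => omega

theorem mem_lowerCentralSeries (h : IteratedCommutator S i x) :
    x ∈ (⊤ : Subgroup G).lowerCentralSeries (i - 1) := by
  induction h with
  | base => simp
  | @comm i j x y hx hy ihx ihy =>
    have := Subgroup.commutator_lowerCentralSeries_le _ _
      (Subgroup.commutator_mem_commutator ihx ihy)
    have h₁ := hx.one_le
    have h₂ := hy.one_le
    rwa [show i - 1 + (j - 1) + 1 = i + j - 1 by omega] at this

theorem finite (hS : S.Finite) (i : ℕ) : {x | IteratedCommutator S i x}.Finite := by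
  induction i using Nat.strong_induction_on with
  | _ n ih =>
    have hfin : (⋃ a : Fin n, ⋃ b : Fin n, Set.image2 (fun x y : G => ⁅x, y⁆)
        {x | IteratedCommutator S a x} {x | IteratedCommutator S b x}).Finite :=
      Set.finite_iUnion fun a => Set.finite_iUnion fun b =>
        (ih a a.2).image2 _ (ih b b.2)
    refine ((hS.union hS.inv).union hfin).subset ?_
    intro x hx
    cases hx with
    | base h => exact Or.inl (by simpa using h)
    | @comm i j x y hx hy =>
      have h₁ := hx.one_le
      have h₂ := hy.one_le
      refine Or.inr (Set.mem_iUnion.2 ⟨⟨i, by omega⟩, Set.mem_iUnion.2 ⟨⟨j, by omega⟩, ?_⟩⟩)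
      exact ⟨x, hx, y, hy, rfl⟩

end IteratedCommutator

/-- The subgroup generated by the iterated commutators of weight at least `i`. -/
def weightSubgroup (S : Set G) (i : ℕ) : Subgroup G :=
  Subgroup.closure {x | ∃ j, i ≤ j ∧ IteratedCommutator S j x}

variable {S : Set G}

theorem IteratedCommutator.mem_weightSubgroup {i j : ℕ} {x : G} (h : IteratedCommutator S j x)
    (hij : i ≤ j) : x ∈ weightSubgroup S i :=
  Subgroup.subset_closure ⟨j, hij, h⟩

theorem weightSubgroup_anti {i j : ℕ} (h : i ≤ j) : weightSubgroup S j ≤ weightSubgroup S i :=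
  Subgroup.closure_mono fun _ ⟨k, hk, hx⟩ => ⟨k, h.trans hk, hx⟩

/-- Conjugating an iterated commutator `x` by a generator `s` gives `⁅s, x⁆ * x`, and `⁅s, x⁆` has
weight one more. -/
theorem weightSubgroup_normal (hS : Subgroup.closure S = ⊤) (i : ℕ) :
    (weightSubgroup S i).Normal := by
  have conj : ∀ s, s ∈ S ∨ s⁻¹ ∈ S → ∀ g ∈ weightSubgroup S i, s * g * s⁻¹ ∈ weightSubgroup S i := by
    intro s hs g hg
    induction hg using Subgroup.closure_induction with
    | mem x hx =>
      obtain ⟨j, hj, hx⟩ := hx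
      have : s * x * s⁻¹ = ⁅s, x⁆ * x := by simp [commutatorElement_def]
      rw [this]
      exact mul_mem (((IteratedCommutator.base hs).comm hx).mem_weightSubgroup (by omega))
        (hx.mem_weightSubgroup hj)
    | one => simp
    | mul x y _ _ hx hy => simpa [mul_assoc] using mul_mem hx hy
    | inv x _ hx => simpa [mul_assoc] using inv_mem hx
  refine ⟨fun g hg s => ?_⟩
  have hs : s ∈ Subgroup.closure S := hS ▸ Subgroup.mem_top s
  revert g
  induction hs using Subgroup.closure_induction'' with
  | mem x hx => exact conj x (Or.inl hx)
  | inv_mem x hx => exact conj x⁻¹ (Or.inr (by simpa using hx))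
  | one => simp
  | mul x y _ _ hx hy =>
    intro g hg
    simpa [mul_assoc] using hx _ (hy g hg)

/-- Modulo the normal subgroup on the right, the generators of the two groups commute, hence so do
the groups. -/
theorem commutator_weightSubgroup_le (hS : Subgroup.closure S = ⊤) (i j : ℕ) :
    ⁅weightSubgroup S i, weightSubgroup S j⁆ ≤ weightSubgroup S (i + j) := by
  have := weightSubgroup_normal hS (i + j)
  rw [← QuotientGroup.ker_mk' (weightSubgroup S (i + j)), ← Subgroup.map_eq_bot_iff,
    Subgroup.map_commutator, Subgroup.commutator_eq_bot_iff_le_centralizer,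
    weightSubgroup.eq_1 S i, weightSubgroup.eq_1 S j, MonoidHom.map_closure, MonoidHom.map_closure,
    Subgroup.closure_le]
  rintro _ ⟨x, ⟨a, ha, hx⟩, rfl⟩
  rw [SetLike.mem_coe, Subgroup.centralizer_closure, Subgroup.mem_centralizer_iff]
  rintro _ ⟨y, ⟨b, hb, hy⟩, rfl⟩
  rw [← commutatorElement_eq_one_iff_mul_comm, ← map_commutatorElement]
  exact (QuotientGroup.eq_one_iff _).2 ((hy.comm hx).mem_weightSubgroup (by omega))

theorem commutator_pow_left_of_central {x y : G} (hz : ∀ g, Commute ⁅x, y⁆ g) (q : ℕ) :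
    ⁅x ^ q, y⁆ = ⁅x, y⁆ ^ q := by
  induction q with
  | zero => simp
  | succ q ih =>
    rw [pow_succ', commutatorElement_mul_left_eq_conj_mul, ih,
      ((hz x).symm.pow_right q).eq, mul_inv_cancel_right, pow_succ]

theorem commutator_pow_pow_of_central {x y : G} (hz : ∀ g, Commute ⁅x, y⁆ g) (q s : ℕ) :
    ⁅x ^ q, y ^ s⁆ = ⁅x, y⁆ ^ (q * s) := by
  have h₁ : ∀ g, Commute ⁅y, x⁆ g := fun g => by
    rw [← commutatorElement_inv]; exact (hz g).inv_left
  have h₂ : ⁅x, y ^ s⁆ = ⁅x, y⁆ ^ s := by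
    rw [← commutatorElement_inv, commutator_pow_left_of_central h₁, ← inv_pow,
      commutatorElement_inv]
  rw [commutator_pow_left_of_central (by rw [h₂]; exact fun g => (hz g).pow_left s), h₂, ← pow_mul,
    mul_comm]

theorem commutator_mul_left_of_commute {a u v : G} (hz : ∀ g, Commute ⁅u, v⁆ g)
    (h : Commute a v) : ⁅a * u, v⁆ = ⁅u, v⁆ := by
  rw [commutatorElement_mul_left_eq_conj_mul, (hz a).symm.eq, mul_inv_cancel_right, h.commutator_eq,
    mul_one]

theorem commutator_mul_mul_of_commute {a b u v : G} (hz : ∀ g, Commute ⁅u, v⁆ g)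
    (hav : Commute a v) (hbu : Commute b u) (hab : Commute a b) : ⁅a * u, b * v⁆ = ⁅u, v⁆ := by
  have h₁ : ⁅u, b * v⁆ = ⁅u, v⁆ := by
    have hz' : ∀ g, Commute ⁅v, u⁆ g := fun g => by
      rw [← commutatorElement_inv]; exact (hz g).inv_left
    rw [← commutatorElement_inv, commutator_mul_left_of_commute hz' hbu, commutatorElement_inv]
  rw [commutator_mul_left_of_commute (by rwa [h₁]) (hab.mul_right hav), h₁]

theorem commute_mk_of_mem_weightSubgroup (hS : Subgroup.closure S = ⊤) {i j m : ℕ}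
    [(weightSubgroup S m).Normal] (h : m ≤ i + j) {a b : G} (ha : a ∈ weightSubgroup S i)
    (hb : b ∈ weightSubgroup S j) :
    Commute (a : G ⧸ weightSubgroup S m) (b : G ⧸ weightSubgroup S m) := by
  have := weightSubgroup_anti h
    (commutator_weightSubgroup_le hS i j (Subgroup.commutator_mem_commutator ha hb))
  rw [← commutatorElement_eq_one_iff_commute]
  have h' := (QuotientGroup.eq_one_iff (N := weightSubgroup S m) _).2 this
  rwa [← QuotientGroup.mk'_apply, map_commutatorElement] at h'

/-- Distortion of iterated commutators: up to terms of higher weight, the `e`-th power of a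
commutator of weight `i` has length `O(n)` as long as `e ≤ n ^ i`. -/
theorem IteratedCommutator.exists_approx_pow (hS : Subgroup.closure S = ⊤) {i : ℕ} {x : G}
    (hx : IteratedCommutator S i x) :
    ∃ K : ℕ, ∀ n : ℕ, 1 ≤ n → ∀ e : ℕ, e ≤ n ^ i →
      ∃ a ∈ weightSubgroup S (i + 1), a * x ^ e ∈ wordBall S (K * n) := by
  induction hx with
  | @base x h =>
    refine ⟨1, fun n _ e he => ⟨1, one_mem _, ?_⟩⟩
    have := pow_mem_wordBall (mem_wordBall_one h) e
    simp only [one_mul]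
    exact wordBall_mono (by simpa using he) this
  | @comm i j x y hx hy ihx ihy =>
    obtain ⟨K, hK⟩ := ihx
    obtain ⟨K', hK'⟩ := ihy
    refine ⟨4 * (K + K'), fun n hn e he => ?_⟩
    have hnj : 0 < n ^ j := pow_pos hn j
    have hni : 1 ≤ n ^ i := Nat.one_le_pow _ _ hn
    have := weightSubgroup_normal hS (i + j + 1)
    have hx' := hx.mem_weightSubgroup (S := S) le_rfl
    have hy' := hy.mem_weightSubgroup (S := S) le_rfl
    have top : ∀ g : G, g ∈ weightSubgroup S 1 := by
      intro g
      have : (⊤ : Subgroup G) ≤ weightSubgroup S 1 := by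
        rw [← hS, Subgroup.closure_le]
        exact fun s hs => (IteratedCommutator.base (Or.inl hs)).mem_weightSubgroup le_rfl
      exact this (Subgroup.mem_top g)
    let π := QuotientGroup.mk' (weightSubgroup S (i + j + 1))
    have hz : ∀ g, Commute ⁅π x, π y⁆ g := by
      intro g
      obtain ⟨g, rfl⟩ := QuotientGroup.mk'_surjective _ g
      rw [← map_commutatorElement]
      exact commute_mk_of_mem_weightSubgroup hS le_rfl
        ((hx.comm hy).mem_weightSubgroup (S := S) le_rfl) (top g)
    -- Modulo weight `i + j + 1` the commutator is central and bilinear, and the corrections `a`,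
    -- `b` drop out, so one commutator of length `O(n)` realises the exponent `q * s`.
    have key : ∀ q ≤ n ^ i, ∀ s ≤ n ^ j, ∃ h ∈ wordBall S (2 * (K + K') * n),
        π h = ⁅π x, π y⁆ ^ (q * s) := by
      intro q hq s hs
      obtain ⟨a, ha, ha'⟩ := hK n hn q hq
      obtain ⟨b, hb, hb'⟩ := hK' n hn s hs
      refine ⟨⁅a * x ^ q, b * y ^ s⁆,
        wordBall_mono (le_of_eq (by ring)) (commutator_mem_wordBall ha' hb'), ?_⟩
      rw [map_commutatorElement, map_mul, map_mul, map_pow, map_pow,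
        ← commutator_pow_pow_of_central hz]
      refine commutator_mul_mul_of_commute ?_ ?_ ?_ ?_
      · rw [commutator_pow_pow_of_central hz]; exact fun g => (hz g).pow_left _
      · exact (commute_mk_of_mem_weightSubgroup hS (by omega) ha hy').pow_right _
      · exact (commute_mk_of_mem_weightSubgroup hS (by omega) hb hx').pow_right _
      · exact commute_mk_of_mem_weightSubgroup hS (by omega) ha hb
    -- Division with remainder by `n ^ j` writes `e` as a sum of two admissible products, `(e / n ^
    -- j) * n ^ j` and `1 * (e % n ^ j)`.
    obtain ⟨h₁, h₁', e₁⟩ := key (e / n ^ j)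
      (Nat.div_le_of_le_mul (by rwa [pow_add, mul_comm] at he)) (n ^ j) le_rfl
    obtain ⟨h₂, h₂', e₂⟩ := key 1 hni (e % n ^ j) (Nat.mod_lt e hnj).le
    have hπ : π (h₁ * h₂) = π (⁅x, y⁆ ^ e) := by
      rw [map_mul, e₁, e₂, ← pow_add, one_mul, Nat.div_add_mod', map_pow, map_commutatorElement]
    refine ⟨h₁ * h₂ * (⁅x, y⁆ ^ e)⁻¹, ?_, ?_⟩
    · rw [← QuotientGroup.eq_one_iff]
      change π _ = 1
      rw [map_mul, map_inv, hπ, mul_inv_cancel]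
    · rw [inv_mul_cancel_right]
      exact wordBall_mono (le_of_eq (by ring)) (wordBall_mul_mem h₁' h₂')

end Commutators

/-! ### Words with weighted cost -/

section WeightedWords

variable {G : Type*} [Group G]

/-- Products of letters from `R j ∪ (R j)⁻¹`, a letter of weight `j` costing `n ^ (-j)`, of total
cost at most `C`. -/
def weightedWords (R : ℕ → Set G) (n : ℕ) (C : ℝ) : Set G :=
  {g | ∃ l : List (ℕ × G), (∀ p ∈ l, p.2 ∈ R p.1 ∨ p.2⁻¹ ∈ R p.1) ∧
    (l.map fun p => ((n : ℝ) ^ p.1)⁻¹).sum ≤ C ∧ (l.map Prod.snd).prod = g}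

variable {R : ℕ → Set G} {n : ℕ} {C C' : ℝ} {g h : G}

theorem weightedWords_mono (h : C ≤ C') : weightedWords R n C ⊆ weightedWords R n C' :=
  fun _ ⟨l, hl, hc, hp⟩ => ⟨l, hl, hc.trans h, hp⟩

theorem one_mem_weightedWords (h : 0 ≤ C) : 1 ∈ weightedWords R n C :=
  ⟨[], by simp, by simpa using h, by simp⟩

theorem weightedWords_mul_mem (hg : g ∈ weightedWords R n C) (hh : h ∈ weightedWords R n C') :
    g * h ∈ weightedWords R n (C + C') := by
  obtain ⟨l, hl, hc, rfl⟩ := hg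
  obtain ⟨l', hl', hc', rfl⟩ := hh
  refine ⟨l ++ l', fun p hp => ?_, by simpa using add_le_add hc hc', by simp⟩
  rcases List.mem_append.1 hp with hp | hp
  · exact hl p hp
  · exact hl' p hp

theorem weightedWords_inv_mem (hg : g ∈ weightedWords R n C) : g⁻¹ ∈ weightedWords R n C := by
  obtain ⟨l, hl, hc, rfl⟩ := hg
  refine ⟨(l.map fun p => (p.1, p.2⁻¹)).reverse, fun p hp => ?_, ?_, ?_⟩
  · simp only [List.mem_reverse, List.mem_map] at hp
    obtain ⟨q, hq, rfl⟩ := hp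
    simpa [or_comm] using hl q hq
  · rw [List.map_reverse, List.sum_reverse, List.map_map]
    exact hc
  · rw [List.prod_inv_reverse, List.map_reverse, List.map_map, List.map_map]
    rfl

theorem letter_mem_weightedWords {j : ℕ} (hg : g ∈ R j ∨ g⁻¹ ∈ R j) :
    g ∈ weightedWords R n ((n : ℝ) ^ j)⁻¹ :=
  ⟨[(j, g)], by simpa using hg, by simp, by simp⟩

theorem weightedWords_pow_mem (hg : g ∈ weightedWords R n C) (q : ℕ) :
    g ^ q ∈ weightedWords R n (q * C) := by
  induction q with
  | zero => simpa using one_mem_weightedWords le_rfl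
  | succ q ih =>
    rw [pow_succ]
    exact weightedWords_mono (le_of_eq (by push_cast; ring)) (weightedWords_mul_mem ih hg)

theorem weightedWords_zpow_mem (hg : g ∈ weightedWords R n C) (q : ℤ) :
    g ^ q ∈ weightedWords R n (q.natAbs * C) := by
  rcases Int.natAbs_eq q with h | h
  · rw [h, zpow_natCast, Int.natAbs_natCast]
    exact weightedWords_pow_mem hg _
  · rw [h, zpow_neg, zpow_natCast, Int.natAbs_neg, Int.natAbs_natCast]
    exact weightedWords_inv_mem (weightedWords_pow_mem hg _)

/-- An element of the group generated by letters of weight at least `i` has cost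
`O(n ^ (-i))`. -/
theorem exists_mem_weightedWords_of_mem_closure {i : ℕ} (hR : ∀ j y, y ∈ R j → i ≤ j)
    (hg : g ∈ Subgroup.closure {y | ∃ j, y ∈ R j}) :
    ∃ N : ℕ, ∀ n : ℕ, 1 ≤ n → g ∈ weightedWords R n (N * ((n : ℝ) ^ i)⁻¹) := by
  induction hg using Subgroup.closure_induction with
  | mem y hy =>
    obtain ⟨j, hy⟩ := hy
    refine ⟨1, fun n hn => weightedWords_mono ?_ (letter_mem_weightedWords (Or.inl hy))⟩
    have hn' : (1 : ℝ) ≤ n := by exact_mod_cast hn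
    rw [Nat.cast_one, one_mul]
    exact inv_anti₀ (by positivity) (pow_le_pow_right₀ hn' (hR j y hy))
  | one => exact ⟨0, fun n _ => one_mem_weightedWords (by simp)⟩
  | mul x y _ _ hx hy =>
    obtain ⟨N, hN⟩ := hx
    obtain ⟨N', hN'⟩ := hy
    refine ⟨N + N', fun n hn => weightedWords_mono (le_of_eq (by push_cast; ring))
      (weightedWords_mul_mem (hN n hn) (hN' n hn))⟩
  | inv x _ hx =>
    obtain ⟨N, hN⟩ := hx
    exact ⟨N, fun n hn => weightedWords_inv_mem (hN n hn)⟩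

end WeightedWords

/-! ### The collection process -/

section Collection

variable {G : Type*} [Group G] {S Q : Set G} {i : ℕ} {x g : G} {n : ℕ} {C : ℝ}

/-- The letters consisting of all iterated commutators of weight greater than `i`, and of the
elements of `Q` with weight `i`. -/
def commutatorLetters (S : Set G) (i : ℕ) (Q : Set G) (j : ℕ) : Set G :=
  {y | i < j ∧ IteratedCommutator S j y ∨ j = i ∧ y ∈ Q}

theorem iteratedCommutator_of_mem_commutatorLetters (hQ : ∀ y ∈ Q, IteratedCommutator S i y)
    {j : ℕ} {y : G} (hy : y ∈ commutatorLetters S i Q j ∨ y⁻¹ ∈ commutatorLetters S i Q j) :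
    i ≤ j ∧ IteratedCommutator S j y := by
  have aux : ∀ y ∈ commutatorLetters S i Q j, i ≤ j ∧ IteratedCommutator S j y := by
    rintro y (⟨h, hy⟩ | ⟨rfl, hyQ⟩)
    · exact ⟨h.le, hy⟩
    · exact ⟨le_rfl, hQ y hyQ⟩
  rcases hy with hy | hy
  · exact aux y hy
  · exact ⟨(aux _ hy).1, by simpa using (aux _ hy).2.inv⟩

/-- Each letter `y` becomes `⁅x, y⁆ * y`, and the new letter costs `n^(-i)` times as much as `y`.
Its weight exceeds `i`, so it is available whatever `Q` is. -/
theorem conj_mem_weightedWords (hQ : ∀ y ∈ Q, IteratedCommutator S i y)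
    (hx : IteratedCommutator S i x) (hg : g ∈ weightedWords (commutatorLetters S i Q) n C) :
    x * g * x⁻¹ ∈ weightedWords (commutatorLetters S i Q) n ((1 + ((n : ℝ) ^ i)⁻¹) * C) := by
  obtain ⟨l, hl, hc, rfl⟩ := hg
  refine weightedWords_mono (mul_le_mul_of_nonneg_left hc (by positivity)) ?_
  clear hc
  induction l with
  | nil => simpa using one_mem_weightedWords le_rfl
  | cons p l ih =>
    obtain ⟨j, y⟩ := p
    have hy := hl (j, y) (by simp)
    obtain ⟨hij, hy'⟩ := iteratedCommutator_of_mem_commutatorLetters hQ hy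
    have h₁ : ⁅x, y⁆ ∈ commutatorLetters S i Q (i + j) :=
      Or.inl ⟨by have := hy'.one_le; omega, hx.comm hy'⟩
    have h := weightedWords_mul_mem (weightedWords_mul_mem
      (letter_mem_weightedWords (n := n) (Or.inl h₁)) (letter_mem_weightedWords hy))
      (ih fun p hp => hl p (List.mem_cons_of_mem _ hp))
    have e : x * (((j, y) :: l).map Prod.snd).prod * x⁻¹ =
        ⁅x, y⁆ * y * (x * (l.map Prod.snd).prod * x⁻¹) := by
      simp [commutatorElement_def, mul_assoc]
    rw [e]
    refine weightedWords_mono (le_of_eq ?_) h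
    simp only [List.map_cons, List.sum_cons, pow_add, mul_inv]
    ring

/-- Collecting all occurrences of a letter `x` on the right. -/
theorem exists_collect (hn : 1 ≤ n) (hQ : ∀ y ∈ Q, IteratedCommutator S i y)
    (hx : IteratedCommutator S i x)
    (hg : g ∈ weightedWords (commutatorLetters S i (insert x Q)) n C) :
    ∃ e : ℤ, (e.natAbs : ℝ) ≤ C * (n : ℝ) ^ i ∧
      g * x ^ (-e) ∈ weightedWords (commutatorLetters S i Q) n (C * Real.exp C) := by
  have hni : (0 : ℝ) < (n : ℝ) ^ i := pow_pos (by exact_mod_cast hn) i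
  obtain ⟨l, hl, hc, rfl⟩ := hg
  set w : List (ℕ × G) → ℝ := fun l => (l.map fun p => ((n : ℝ) ^ p.1)⁻¹).sum with hw
  have w_nonneg : ∀ l, 0 ≤ w l := fun l => List.sum_nonneg (by
    intro a ha
    obtain ⟨p, -, rfl⟩ := List.mem_map.1 ha
    positivity)
  -- Here `m` counts the occurrences of `x` and `x⁻¹`, while `e` is their signed sum; the cost of
  -- conjugation depends on `m`.
  have key : ∀ l : List (ℕ × G), (∀ p ∈ l, p.2 ∈ commutatorLetters S i (insert x Q) p.1 ∨
      p.2⁻¹ ∈ commutatorLetters S i (insert x Q) p.1) →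
      ∃ (m : ℕ) (e : ℤ), e.natAbs ≤ m ∧ m * ((n : ℝ) ^ i)⁻¹ ≤ w l ∧
        (l.map Prod.snd).prod * x ^ (-e) ∈ weightedWords (commutatorLetters S i Q) n
          ((1 + ((n : ℝ) ^ i)⁻¹) ^ m * w l) := by
    intro l hl
    induction l with
    | nil =>
      refine ⟨0, 0, le_rfl, by simp [hw], ?_⟩
      simpa [hw] using one_mem_weightedWords le_rfl
    | cons p l ih =>
      obtain ⟨m, e, hem, hm, h⟩ := ih fun p hp => hl p (List.mem_cons_of_mem _ hp)
      obtain ⟨j, y⟩ := p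
      have hwl : w ((j, y) :: l) = ((n : ℝ) ^ j)⁻¹ + w l := by simp [hw]
      have hj : (0 : ℝ) ≤ ((n : ℝ) ^ j)⁻¹ := by positivity
      by_cases hy : y ∈ commutatorLetters S i Q j ∨ y⁻¹ ∈ commutatorLetters S i Q j
      · refine ⟨m, e, hem, by rw [hwl]; linarith, ?_⟩
        have h' := weightedWords_mul_mem (letter_mem_weightedWords hy) h
        rw [← mul_assoc] at h'
        rw [List.map_cons, List.prod_cons]
        refine weightedWords_mono ?_ h'
        rw [hwl, mul_add]
        refine add_le_add ?_ le_rfl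
        exact le_mul_of_one_le_left hj (one_le_pow₀ (le_add_of_nonneg_right (by positivity)))
      · have hcase : j = i ∧ (y = x ∨ y = x⁻¹) := by
          have := hl (j, y) (by simp)
          simp only [commutatorLetters, Set.mem_ofPred_eq, Set.mem_insert_iff] at this hy
          rcases this with (h | ⟨h, h' | h'⟩) | (h | ⟨h, h' | h'⟩)
          · exact absurd (Or.inl (Or.inl h)) hy
          · exact ⟨h, Or.inl h'⟩
          · exact absurd (Or.inl (Or.inr ⟨h, h'⟩)) hy
          · exact absurd (Or.inr (Or.inl h)) hy
          · exact ⟨h, Or.inr (by rw [← h', inv_inv])⟩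
          · exact absurd (Or.inr (Or.inr ⟨h, h'⟩)) hy
        obtain ⟨rfl, hyx⟩ := hcase
        have bound : (1 + ((n : ℝ) ^ j)⁻¹) * ((1 + ((n : ℝ) ^ j)⁻¹) ^ m * w l) ≤
            (1 + ((n : ℝ) ^ j)⁻¹) ^ (m + 1) * w ((j, y) :: l) := by
          rw [← mul_assoc, ← pow_succ', hwl]
          exact mul_le_mul_of_nonneg_left (by linarith) (by positivity)
        have hm' : ((m + 1 : ℕ) : ℝ) * ((n : ℝ) ^ j)⁻¹ ≤ w ((j, y) :: l) := by
          rw [hwl]; push_cast; linarith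
        rcases hyx with rfl | rfl
        · refine ⟨m + 1, e + 1, by omega, hm', weightedWords_mono bound ?_⟩
          have := conj_mem_weightedWords hQ hx h
          rw [List.map_cons, List.prod_cons]
          rw [show -(e + 1) = -e - 1 by ring, zpow_sub_one]
          simpa only [mul_assoc] using this
        · refine ⟨m + 1, e - 1, by omega, hm', weightedWords_mono bound ?_⟩
          have := conj_mem_weightedWords hQ hx.inv h
          rw [List.map_cons, List.prod_cons]
          rw [show -(e - 1) = -e + 1 by ring, zpow_add_one]
          simpa only [mul_assoc, inv_inv] using this
  obtain ⟨m, e, hem, hm, h⟩ := key l hl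
  have hmC : m * ((n : ℝ) ^ i)⁻¹ ≤ C := hm.trans hc
  refine ⟨e, ?_, weightedWords_mono ?_ h⟩
  · refine le_trans (Nat.cast_le.2 hem) ?_
    rwa [← div_eq_mul_inv, div_le_iff₀ hni] at hmC
  · rw [mul_comm C]
    refine mul_le_mul ?_ hc (w_nonneg l) (Real.exp_pos _).le
    -- At most `C * n ^ i` conjugations occur, so the cost grows by a factor bounded independently
    -- of `n`.
    calc (1 + ((n : ℝ) ^ i)⁻¹) ^ m ≤ Real.exp (((n : ℝ) ^ i)⁻¹) ^ m := by
          refine pow_le_pow_left₀ (by positivity) ?_ m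
          rw [add_comm]; exact Real.add_one_le_exp _
      _ = Real.exp (m * ((n : ℝ) ^ i)⁻¹) := (Real.exp_nat_mul _ m).symm
      _ ≤ Real.exp C := Real.exp_le_exp.2 hmC

end Collection

/-! ### Polynomial growth of nilpotent groups -/

section Counting

variable {G : Type*} [Group G] {S Q : Set G} {i k : ℕ} {x : G}

/-- The words of bounded cost in the letters `R` number `O(n ^ k)`, and the group they generate
contains at least `n ^ k` elements of length `O(n)` with regard to `S`. -/
structure HasGrowthDegree (S : Set G) (R : ℕ → Set G) (k : ℕ) : Prop where
  upper : ∀ C : ℝ, ∃ D : ℕ, ∀ n : ℕ, 1 ≤ n →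
    (weightedWords R n C).Finite ∧ (weightedWords R n C).ncard ≤ D * n ^ k
  lower : ∃ K : ℕ, ∀ n : ℕ, 1 ≤ n → ∃ F : Finset G,
    (∀ f ∈ F, f ∈ Subgroup.closure {y | ∃ j, y ∈ R j} ∧ f ∈ wordBall S (K * n)) ∧ n ^ k ≤ F.card

theorem ncard_image2_le {α β γ : Type*} {s : Set α} {t : Set β} (f : α → β → γ) (hs : s.Finite)
    (ht : t.Finite) : (Set.image2 f s t).ncard ≤ s.ncard * t.ncard := by
  rw [← Set.image_uncurry_prod, ← Set.ncard_prod]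
  exact Set.ncard_image_le (hs.prod ht)

/-- The collected power splits as `(x ^ m) ^ (e / m) * x ^ (e % m)`. The first factor has bounded
cost, `O(n^i)` copies at `O(n^(-i))` each, and the second takes only `m` values. -/
theorem HasGrowthDegree.insert_of_pow_mem (hQ : ∀ y ∈ Q, IteratedCommutator S i y)
    (hx : IteratedCommutator S i x) (h : HasGrowthDegree S (commutatorLetters S i Q) k) {m : ℕ}
    (hm : 1 ≤ m) (hxm : x ^ m ∈ Subgroup.closure {y | ∃ j, y ∈ commutatorLetters S i Q j}) :
    HasGrowthDegree S (commutatorLetters S i (insert x Q)) k := by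
  refine ⟨fun C => ?_, ?_⟩
  · obtain ⟨N, hN⟩ := exists_mem_weightedWords_of_mem_closure
      (fun j y hy => (iteratedCommutator_of_mem_commutatorLetters hQ (Or.inl hy)).1) hxm
    obtain ⟨D, hD⟩ := h.upper (C * Real.exp C + C * N)
    refine ⟨D * m, fun n hn => ?_⟩
    have hni : (0 : ℝ) < (n : ℝ) ^ i := pow_pos (by exact_mod_cast hn) i
    obtain ⟨hfin, hcard⟩ := hD n hn
    have hIco : (Set.Ico (0 : ℤ) m).Finite := Set.finite_Ico _ _
    have hsub : weightedWords (commutatorLetters S i (insert x Q)) n C ⊆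
        Set.image2 (fun g (r : ℤ) => g * x ^ r)
          (weightedWords (commutatorLetters S i Q) n (C * Real.exp C + C * N))
          (Set.Ico (0 : ℤ) m) := by
      intro g hg
      obtain ⟨e, he, hg'⟩ := exists_collect hn hQ hx hg
      have hm0 : (m : ℤ) ≠ 0 := by omega
      refine ⟨g * x ^ (-e) * (x ^ m) ^ (e / m), ?_, e % m,
        ⟨Int.emod_nonneg _ hm0, Int.emod_lt_of_pos _ (by omega)⟩, ?_⟩
      · refine weightedWords_mono (add_le_add le_rfl ?_)
          (weightedWords_mul_mem hg' (weightedWords_zpow_mem (hN n hn) (e / m)))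
        have h₁ : (e / m).natAbs ≤ e.natAbs := Int.natAbs_ediv_le_natAbs _ _
        calc ((e / m).natAbs : ℝ) * (N * ((n : ℝ) ^ i)⁻¹)
            ≤ (C * (n : ℝ) ^ i) * (N * ((n : ℝ) ^ i)⁻¹) :=
              mul_le_mul_of_nonneg_right ((Nat.cast_le.2 h₁).trans he) (by positivity)
          _ = C * N := by field_simp
      · simp only [mul_assoc]
        rw [← zpow_natCast, ← zpow_mul, ← zpow_add, ← zpow_add, Int.mul_ediv_add_emod, neg_add_cancel,
          zpow_zero, mul_one]
    refine ⟨(hfin.image2 _ hIco).subset hsub, ?_⟩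
    calc _ ≤ _ := Set.ncard_le_ncard hsub (hfin.image2 _ hIco)
      _ ≤ _ := ncard_image2_le _ hfin hIco
      _ ≤ (D * n ^ k) * m := Nat.mul_le_mul hcard (by
          rw [← Finset.coe_Ico, Set.ncard_coe_finset]; simp)
      _ = D * m * n ^ k := by ring
  · obtain ⟨K, hK⟩ := h.lower
    refine ⟨K, fun n hn => ?_⟩
    obtain ⟨F, hF, hcard⟩ := hK n hn
    refine ⟨F, fun f hf => ⟨Subgroup.closure_mono ?_ (hF f hf).1, (hF f hf).2⟩, hcard⟩
    rintro y ⟨j, hj | ⟨hj, hy⟩⟩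
    · exact ⟨j, Or.inl hj⟩
    · exact ⟨j, Or.inr ⟨hj, Set.mem_insert_of_mem _ hy⟩⟩

/-- The collected exponent takes `O(n^i)` values, which bounds the count above. Below, the products
`f * (a e * x ^ e)` with `e < n ^ i` are distinct: `f` and `a e` lie in the old subgroup, so a
coincidence with different exponents would put a positive power of `x` there. -/
theorem HasGrowthDegree.insert_of_pow_notMem (hS : Subgroup.closure S = ⊤)
    (hQ : ∀ y ∈ Q, IteratedCommutator S i y)
    (hx : IteratedCommutator S i x) (h : HasGrowthDegree S (commutatorLetters S i Q) k)
    (hxm : ∀ m : ℕ, 1 ≤ m →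
      x ^ m ∉ Subgroup.closure {y | ∃ j, y ∈ commutatorLetters S i Q j}) :
    HasGrowthDegree S (commutatorLetters S i (insert x Q)) (k + i) := by
  classical
  refine ⟨fun C => ?_, ?_⟩
  · obtain ⟨D, hD⟩ := h.upper (C * Real.exp C)
    refine ⟨D * (2 * ⌈C⌉₊ + 1), fun n hn => ?_⟩
    obtain ⟨hfin, hcard⟩ := hD n hn
    set M : ℕ := ⌈C⌉₊ * n ^ i with hM
    have hIcc : (Set.Icc (-M : ℤ) M).Finite := Set.finite_Icc _ _
    have hsub : weightedWords (commutatorLetters S i (insert x Q)) n C ⊆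
        Set.image2 (fun g (r : ℤ) => g * x ^ r)
          (weightedWords (commutatorLetters S i Q) n (C * Real.exp C)) (Set.Icc (-M : ℤ) M) := by
      intro g hg
      obtain ⟨e, he, hg'⟩ := exists_collect hn hQ hx hg
      have he' : e.natAbs ≤ M := by
        have : (e.natAbs : ℝ) ≤ M := he.trans (by
          rw [hM]; push_cast
          exact mul_le_mul_of_nonneg_right (Nat.le_ceil C) (by positivity))
        exact_mod_cast this
      exact ⟨g * x ^ (-e), hg', e, Set.mem_Icc.2 ⟨by omega, by omega⟩, by simp⟩
    refine ⟨(hfin.image2 _ hIcc).subset hsub, ?_⟩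
    have hni : 1 ≤ n ^ i := Nat.one_le_pow _ _ hn
    calc _ ≤ _ := Set.ncard_le_ncard hsub (hfin.image2 _ hIcc)
      _ ≤ _ := ncard_image2_le _ hfin hIcc
      _ ≤ (D * n ^ k) * ((2 * ⌈C⌉₊ + 1) * n ^ i) := Nat.mul_le_mul hcard (by
          rw [← Finset.coe_Icc, Set.ncard_coe_finset, Int.card_Icc]
          have : (2 * ⌈C⌉₊ + 1) * n ^ i = 2 * M + n ^ i := by rw [hM]; ring
          omega)
      _ = D * (2 * ⌈C⌉₊ + 1) * n ^ (k + i) := by rw [pow_add]; ring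
  · obtain ⟨K, hK⟩ := h.lower
    obtain ⟨K', hK'⟩ := hx.exists_approx_pow hS
    refine ⟨K + K', fun n hn => ?_⟩
    obtain ⟨F, hF, hcard⟩ := hK n hn
    choose! a ha ha' using hK' n hn
    have hle : ∀ e ≤ n ^ i, a e ∈ Subgroup.closure {y | ∃ j, y ∈ commutatorLetters S i Q j} :=
      fun e he => Subgroup.closure_mono
        (by rintro y ⟨j, hj, hy⟩; exact ⟨j, Or.inl ⟨by omega, hy⟩⟩) (ha e he)
    have hmono : Subgroup.closure {y | ∃ j, y ∈ commutatorLetters S i Q j} ≤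
        Subgroup.closure {y | ∃ j, y ∈ commutatorLetters S i (insert x Q) j} := by
      refine Subgroup.closure_mono ?_
      rintro y ⟨j, hj | ⟨hj, hy⟩⟩
      · exact ⟨j, Or.inl hj⟩
      · exact ⟨j, Or.inr ⟨hj, Set.mem_insert_of_mem _ hy⟩⟩
    refine ⟨(F ×ˢ Finset.range (n ^ i)).image fun p => p.1 * (a p.2 * x ^ p.2), ?_, ?_⟩
    · intro f hf
      obtain ⟨⟨f, e⟩, hp, rfl⟩ := Finset.mem_image.1 hf
      obtain ⟨hf, he⟩ := Finset.mem_product.1 hp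
      have he := (Finset.mem_range.1 he).le
      refine ⟨mul_mem (hmono (hF f hf).1) (mul_mem (hmono (hle e he)) (pow_mem ?_ _)), ?_⟩
      · exact Subgroup.subset_closure ⟨i, Or.inr ⟨rfl, Set.mem_insert _ _⟩⟩
      · rw [add_mul]
        exact wordBall_mul_mem (hF f hf).2 (ha' e he)
    · have aux : ∀ f ∈ F, ∀ f' ∈ F, ∀ e < n ^ i, ∀ e' < n ^ i,
          f * (a e * x ^ e) = f' * (a e' * x ^ e') → e ≤ e' := by
        intro f hf f' hf' e he e' he' heq
        by_contra! hlt
        refine hxm (e - e') (by omega) ?_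
        have : x ^ (e - e') = (f * a e)⁻¹ * (f' * a e') := by
          rw [pow_sub _ hlt.le, eq_inv_mul_iff_mul_eq, ← mul_assoc, mul_inv_eq_iff_eq_mul]
          simpa [mul_assoc] using heq
        rw [this]
        exact mul_mem (inv_mem (mul_mem (hF f hf).1 (hle e he.le)))
          (mul_mem (hF f' hf').1 (hle e' he'.le))
      rw [Finset.card_image_of_injOn, Finset.card_product, Finset.card_range, pow_add]
      · exact Nat.mul_le_mul_right _ hcard
      · rintro ⟨f, e⟩ hp ⟨f', e'⟩ hp' heq
        simp only [Finset.coe_product, Set.mem_prod, Finset.mem_coe, Finset.mem_range] at hp hp'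
        obtain rfl : e = e' := le_antisymm
          (aux f hp.1 f' hp'.1 e hp.2 e' hp'.2 heq)
          (aux f' hp'.1 f hp.1 e' hp'.2 e hp.2 heq.symm)
        simpa using heq

theorem HasGrowthDegree.exists_insert (hS : Subgroup.closure S = ⊤)
    (hQ : ∀ y ∈ Q, IteratedCommutator S i y)
    (hx : IteratedCommutator S i x) (h : HasGrowthDegree S (commutatorLetters S i Q) k) :
    ∃ k', HasGrowthDegree S (commutatorLetters S i (insert x Q)) k' := by
  by_cases hxm : ∃ m : ℕ, 1 ≤ m ∧
      x ^ m ∈ Subgroup.closure {y | ∃ j, y ∈ commutatorLetters S i Q j}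
  · obtain ⟨m, hm, hxm⟩ := hxm
    exact ⟨k, h.insert_of_pow_mem hQ hx hm hxm⟩
  · push Not at hxm
    exact ⟨k + i, h.insert_of_pow_notMem hS hQ hx hxm⟩

theorem exists_hasGrowthDegree (hSf : S.Finite) (hS : Subgroup.closure S = ⊤) {c : ℕ}
    (hc : (⊤ : Subgroup G).lowerCentralSeries c = ⊥) (i : ℕ) :
    ∃ k, HasGrowthDegree S (commutatorLetters S i {x | IteratedCommutator S i x}) k := by
  have triv : ∀ j, c < j → ∀ y, IteratedCommutator S j y → y = 1 := by
    intro j hj y hy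
    have := Subgroup.lowerCentralSeries_antitone _ (by omega : c ≤ j - 1) hy.mem_lowerCentralSeries
    rwa [hc, Subgroup.mem_bot] at this
  -- Downward induction on the weight `i`, started above the class `c`, where all letters are
  -- trivial.
  have step : ∀ d i, c < i + d →
      ∃ k, HasGrowthDegree S (commutatorLetters S i {x | IteratedCommutator S i x}) k := by
    intro d
    induction d with
    | zero =>
      intro i hi
      have hsub : ∀ n C, weightedWords (commutatorLetters S i {x | IteratedCommutator S i x}) n C ⊆
          {1} := by
        rintro n C _ ⟨l, hl, -, rfl⟩
        refine List.prod_eq_one fun y hy => ?_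
        obtain ⟨⟨j, y⟩, hp, rfl⟩ := List.mem_map.1 hy
        obtain ⟨hij, h⟩ := iteratedCommutator_of_mem_commutatorLetters (fun _ h => h) (hl _ hp)
        exact triv _ (by simp only at hij; omega) _ h
      refine ⟨0, fun C => ⟨1, fun n _ => ⟨(Set.finite_singleton 1).subset (hsub n C), ?_⟩⟩,
        0, fun n _ => ⟨{1}, ?_, by simp⟩⟩
      · simpa using Set.ncard_le_ncard (hsub n C)
      · simpa using one_mem_wordBall _
    | succ d ih =>
      intro i hi
      -- No letters of weight `i` is the same alphabet as all letters of weight at least `i + 1`.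
      have base : ∃ k, HasGrowthDegree S (commutatorLetters S i ∅) k := by
        obtain ⟨k, hk⟩ := ih (i + 1) (by omega)
        refine ⟨k, ?_⟩
        convert hk using 1
        ext j y
        simp only [commutatorLetters, Set.mem_ofPred_eq, Set.mem_empty_iff_false, and_false,
          or_false]
        constructor
        · rintro ⟨hj, hy⟩
          rcases eq_or_lt_of_le (Nat.succ_le_of_lt hj) with rfl | h
          · exact Or.inr ⟨rfl, hy⟩
          · exact Or.inl ⟨h, hy⟩
        · rintro (⟨hj, hy⟩ | ⟨rfl, hy⟩)
          · exact ⟨by omega, hy⟩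
          · exact ⟨by omega, hy⟩
      refine Set.Finite.induction_on_subset _ (IteratedCommutator.finite hSf i) base ?_
      rintro x Q hx hQ - ⟨k, hk⟩
      exact hk.exists_insert hS hQ hx
  exact step (c + 1) i (by omega)

theorem exists_growth_bounds_of_isNilpotent [Group.IsNilpotent G] (hSf : S.Finite)
    (hS : Subgroup.closure S = ⊤) :
    ∃ k D K : ℕ, ∀ n : ℕ, 1 ≤ n → growth S n ≤ D * n ^ k ∧ n ^ k ≤ growth S (K * n) := by
  obtain ⟨c, hc⟩ := Subgroup.nilpotent_iff_lowerCentralSeries.1 ‹Group.IsNilpotent G›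
  obtain ⟨k, hk⟩ := exists_hasGrowthDegree hSf hS hc 1
  obtain ⟨D, hD⟩ := hk.upper 1
  obtain ⟨K, hK⟩ := hk.lower
  refine ⟨k, D, K, fun n hn => ⟨?_, ?_⟩⟩
  · refine (Set.ncard_le_ncard ?_ (hD n hn).1).trans (hD n hn).2
    rintro _ ⟨l, hl, hlS, rfl⟩
    refine ⟨l.map fun x => (1, x), fun p hp => ?_, ?_, by simp [Function.comp_def]⟩
    · obtain ⟨x, hx, rfl⟩ := List.mem_map.1 hp
      exact Or.inl (Or.inr ⟨rfl, .base (hlS x hx)⟩)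
    · have hn' : (0 : ℝ) < n := by exact_mod_cast hn
      simp only [List.map_map, Function.comp_def, pow_one, List.map_const', List.sum_replicate,
        nsmul_eq_mul]
      rw [← div_eq_mul_inv, div_le_one hn']
      exact_mod_cast hl
  · obtain ⟨F, hF, hcard⟩ := hK n hn
    refine hcard.trans ?_
    rw [← Set.ncard_coe_finset]
    exact Set.ncard_le_ncard (fun f hf => (hF f hf).2) (wordBall_finite hSf _)

end Counting

/-! ### Passage to finite index and real constants -/

section FiniteIndex

variable {G : Type*} [Group G] {S : Set G}

/-- Schreier rewriting: reading a word while carrying a coset representative, each letter emits an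
element of a finite subset of `N`, and `K` bounds the lengths of these elements. -/
theorem exists_wordBall_subset_mul_of_finiteIndex (hSf : S.Finite) (N : Subgroup G)
    [N.FiniteIndex] {T : Set N} (hT : Subgroup.closure T = ⊤) :
    ∃ (K : ℕ) (R : Set G), R.Finite ∧
      ∀ n, wordBall S n ⊆ ((↑) '' wordBall T (K * n) : Set G) * R := by
  classical
  let rep : G → G := fun g => (Quotient.out (QuotientGroup.mk (s := N) g⁻¹) : G)⁻¹
  have hrep : ∀ g, g * (rep g)⁻¹ ∈ N := fun g => by
    have := QuotientGroup.eq.1 (QuotientGroup.out_eq' (QuotientGroup.mk (s := N) g⁻¹)).symm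
    simpa [rep] using this
  set R : Set G := insert 1 (Set.range rep) with hR
  have hRf : R.Finite := by
    refine Set.Finite.insert _ ((Set.finite_range
      fun q : G ⧸ N => (Quotient.out q : G)⁻¹).subset ?_)
    rintro _ ⟨g, rfl⟩
    exact ⟨_, rfl⟩
  have hfin : {ν : N | (ν : G) ∈ Set.image2 (fun r s => r * s * (rep (r * s))⁻¹) R (S ∪ S⁻¹)}.Finite :=
    (hRf.image2 _ (hSf.union hSf.inv)).preimage Subtype.val_injective.injOn
  obtain ⟨K, hK⟩ := exists_subset_wordBall hT hfin
  refine ⟨K, R, hRf, fun n => ?_⟩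
  induction n with
  | zero =>
    rw [wordBall_zero]
    rintro _ rfl
    exact ⟨1, ⟨1, one_mem_wordBall _, rfl⟩, 1, Set.mem_insert _ _, by simp⟩
  | succ n ih =>
    intro g hg
    obtain ⟨g', hg', s, hs, rfl⟩ := wordBall_succ_subset n hg
    obtain ⟨_, ⟨h, hh, rfl⟩, r, hr, rfl⟩ := ih hg'
    rcases hs with rfl | hs
    · exact ⟨h, ⟨h, wordBall_mono (Nat.mul_le_mul_left _ n.le_succ) hh, rfl⟩, r, hr, by simp⟩
    · let ν : N := ⟨r * s * (rep (r * s))⁻¹, hrep _⟩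
      have hν : ν ∈ wordBall T K := hK ⟨r, hr, s, hs, rfl⟩
      exact ⟨_, ⟨h * ν, wordBall_mul_mem hh hν, rfl⟩, rep (r * s),
        Set.mem_insert_of_mem _ ⟨_, rfl⟩, by simp [ν, mul_assoc]⟩

theorem exists_image_wordBall_subset (hS : Subgroup.closure S = ⊤) (N : Subgroup G) {T : Set N}
    (hT : T.Finite) : ∃ K : ℕ, ∀ n, ((↑) '' wordBall T n : Set G) ⊆ wordBall S (K * n) := by
  obtain ⟨K, hK⟩ := exists_subset_wordBall hS ((hT.union hT.inv).image ((↑) : N → G))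
  refine ⟨K, fun n => ?_⟩
  induction n with
  | zero =>
    rintro _ ⟨g, hg, rfl⟩
    rw [wordBall_zero] at hg
    rw [Set.mem_singleton_iff.1 hg]
    exact one_mem_wordBall _
  | succ n ih =>
    rintro _ ⟨g, hg, rfl⟩
    obtain ⟨g', hg', s, hs, rfl⟩ := wordBall_succ_subset n hg
    refine wordBall_mul_mem (ih ⟨g', hg', rfl⟩) ?_
    rcases hs with rfl | hs
    · exact one_mem_wordBall _
    · exact hK ⟨s, hs, rfl⟩

theorem exists_growth_bounds_of_isVirtuallyNilpotent [Group.FG G]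
    (hG : Group.IsVirtuallyNilpotent G) (hSf : S.Finite) (hS : Subgroup.closure S = ⊤) :
    ∃ k D K : ℕ, ∀ n : ℕ, 1 ≤ n → growth S n ≤ D * n ^ k ∧ n ^ k ≤ growth S (K * n) := by
  obtain ⟨N, hN, hNi⟩ := hG
  obtain ⟨T, hT⟩ := (inferInstance : Group.FG N).1
  obtain ⟨k, D, K, hk⟩ := exists_growth_bounds_of_isNilpotent T.finite_toSet hT
  obtain ⟨K₁, R, hR, h₁⟩ := exists_wordBall_subset_mul_of_finiteIndex hSf N hT
  obtain ⟨K₂, h₂⟩ := exists_image_wordBall_subset hS N T.finite_toSet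
  -- `K₁ + 1` keeps the radius positive, as the bounds for `N` require.
  refine ⟨k, D * (K₁ + 1) ^ k * R.ncard, K₂ * K, fun n hn => ⟨?_, ?_⟩⟩
  · have hfin : ((↑) '' wordBall (T : Set N) ((K₁ + 1) * n) : Set G).Finite :=
      (wordBall_finite T.finite_toSet _).image _
    have hsub : wordBall S n ⊆ ((↑) '' wordBall (T : Set N) ((K₁ + 1) * n) : Set G) * R :=
      (h₁ n).trans (Set.mul_subset_mul_right
        (Set.image_mono (wordBall_mono (Nat.mul_le_mul_right _ K₁.le_succ))))
    calc growth S n ≤ _ := Set.ncard_le_ncard hsub (hfin.mul hR)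
      _ ≤ _ := ncard_image2_le _ hfin hR
      _ ≤ (D * ((K₁ + 1) * n) ^ k) * R.ncard := by
          refine Nat.mul_le_mul_right _ ?_
          rw [Set.ncard_image_of_injective _ Subtype.val_injective]
          exact (hk _ (Nat.mul_pos (Nat.succ_pos _) hn)).1
      _ = _ := by rw [mul_pow]; ring
  · refine (hk n hn).2.trans ?_
    rw [growth, ← Set.ncard_image_of_injective _ (Subtype.val_injective (p := (· ∈ N))), mul_assoc]
    exact Set.ncard_le_ncard (h₂ _) (wordBall_finite hSf _)

/-- For `n ≥ K + 1`, apply the lower bound at `q = n / (K + 1)`, where `n ≤ 2(K+1)q`; for smaller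
`n` the claimed lower bound is at most 1. The summand 1 covers `n = 0`. -/
theorem exists_real_growth_bounds (hSf : S.Finite) {k D K : ℕ}
    (h : ∀ n : ℕ, 1 ≤ n → growth S n ≤ D * n ^ k ∧ n ^ k ≤ growth S (K * n)) :
    ∃ C D : ℝ, 0 < C ∧ C ≤ D ∧
      ∀ n : ℕ, C * (n : ℝ) ^ k ≤ growth S n ∧ (growth S n : ℝ) ≤ D * (n : ℝ) ^ k + 1 := by
  set L : ℝ := 2 * (K + 1) with hL
  have hL1 : 1 ≤ L := by have : (0 : ℝ) ≤ K := K.cast_nonneg; linarith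
  have hC1 : (1 / L) ^ k ≤ 1 := pow_le_one₀ (by positivity) ((div_le_one (by linarith)).2 hL1)
  refine ⟨(1 / L) ^ k, max D 1, by positivity, hC1.trans (le_max_right _ _), fun n => ⟨?_, ?_⟩⟩
  · rw [← mul_pow]
    have h1 : (1 : ℝ) ≤ growth S n := by exact_mod_cast one_le_growth hSf n
    rcases lt_or_ge n (K + 1) with hn | hn
    · refine le_trans (pow_le_one₀ (by positivity) ?_) h1
      rw [one_div_mul_eq_div, div_le_one (by linarith)]
      have : (n : ℝ) < K + 1 := by exact_mod_cast hn
      have : (0 : ℝ) ≤ K := K.cast_nonneg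
      linarith
    · have hq : 1 ≤ n / (K + 1) := (Nat.one_le_div_iff K.succ_pos).2 hn
      have hb := (h _ hq).2.trans (growth_mono hSf (n := n)
        ((Nat.mul_le_mul_right _ K.le_succ).trans (Nat.mul_div_le n (K + 1))))
      have hb' : ((n / (K + 1) : ℕ) : ℝ) ^ k ≤ growth S n := by exact_mod_cast hb
      refine le_trans (pow_le_pow_left₀ (by positivity) ?_ k) hb'
      rw [one_div_mul_eq_div, div_le_iff₀ (by linarith), hL]
      have h3 : n ≤ (n / (K + 1)) * (2 * (K + 1)) := by
        have := Nat.lt_div_mul_add (a := n) K.succ_pos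
        nlinarith
      exact_mod_cast h3
  · rcases Nat.eq_zero_or_pos n with rfl | hn
    · have : growth S 0 = 1 := by simp [growth, wordBall_zero]
      rw [this, Nat.cast_one]
      exact le_add_of_nonneg_left (by positivity)
    · have := (h n hn).1
      have h' : (growth S n : ℝ) ≤ D * (n : ℝ) ^ k := by exact_mod_cast this
      have : (D : ℝ) * (n : ℝ) ^ k ≤ max (D : ℝ) 1 * (n : ℝ) ^ k :=
        mul_le_mul_of_nonneg_right (le_max_left _ _) (by positivity)
      linarith

end FiniteIndex

/-! ### From growth to packing -/

section Packing

variable {G : Type*} [Group G] {S : Set G}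

theorem LSP_le_of_isPackingBound {d m : ℕ} (h : IsPackingBound d G m) : LSP d G ≤ m :=
  iInf₂_le m h

theorem isPackingBound_of_finite [Finite G] (d : ℕ) : IsPackingBound d G (d + 1) := by
  intro L _
  refine ⟨Set.univ, Set.toFinite _, by simp, Set.mem_univ _, fun n hn g _ => ⟨Finset.univ, ?_, ?_⟩⟩
  · simpa using hn
  · simp

/-- Pigeonhole for the translates of a ball. -/
theorem exists_finset_of_growth_lt (hSf : S.Finite) {d n s l : ℕ}
    (hlt : (d + 1) * growth S (3 * s + l) < n * growth S s) {g : Fin n → G}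
    (hg : ∀ i, g i ∈ wordBall S (2 * s + l)) :
    ∃ F : Finset (Fin n), d + 1 < F.card ∧ ∀ i ∈ F, ∀ j ∈ F, g i * (g j)⁻¹ ∈ wordBall S (2 * s) := by
  classical
  set A := (wordBall_finite hSf s).toFinset with hA
  set B := (wordBall_finite hSf (3 * s + l)).toFinset with hB
  have hAc : A.card = growth S s := (Set.ncard_eq_toFinset_card _ _).symm
  have hBc : B.card = growth S (3 * s + l) := (Set.ncard_eq_toFinset_card _ _).symm
  have hmaps : ∀ p ∈ (Finset.univ : Finset (Fin n)) ×ˢ A, p.2 * g p.1 ∈ B := by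
    rintro ⟨i, b⟩ hp
    simp only [hA, hB, Finset.mem_product, Finset.mem_univ, true_and, Set.Finite.mem_toFinset] at hp ⊢
    exact wordBall_mono (by omega) (wordBall_mul_mem hp (hg i))
  obtain ⟨x, -, hx⟩ := Finset.exists_lt_card_fiber_of_mul_lt_card_of_maps_to (n := d + 1) hmaps
    (by rw [Finset.card_product, Finset.card_univ, Fintype.card_fin, hAc, hBc, mul_comm]; exact hlt)
  -- A pair in the fibre over `x` is determined by its index, so the indices are as numerous as the
  -- pairs.
  refine ⟨_, lt_of_lt_of_eq hx (Finset.card_image_of_injOn (f := Prod.fst) ?_).symm, ?_⟩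
  · rintro ⟨i, b⟩ hp ⟨j, b'⟩ hq (rfl : i = j)
    simp only [Finset.coe_filter, Set.mem_ofPred_eq] at hp hq
    simpa using mul_right_cancel (hp.2.trans hq.2.symm)
  · intro i hi j hj
    obtain ⟨⟨i, b⟩, hp, rfl⟩ := Finset.mem_image.1 hi
    obtain ⟨⟨j, b'⟩, hq, rfl⟩ := Finset.mem_image.1 hj
    simp only [hA, Finset.mem_filter, Finset.mem_product, Finset.mem_univ, true_and,
      Set.Finite.mem_toFinset] at hp hq ⊢
    have : g i * (g j)⁻¹ = b⁻¹ * b' := by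
      rw [eq_inv_mul_iff_mul_eq, ← mul_assoc, hp.2, ← hq.2, mul_inv_cancel_right]
    rw [this, two_mul]
    exact wordBall_mul_mem (wordBall_inv_mem hp.1) hq.1

theorem isPackingBound_of_growth (hSf : S.Finite) (hS : Subgroup.closure S = ⊤) {d m : ℕ}
    (h : ∀ l : ℕ, ∃ s, (d + 1) * growth S (3 * s + l) < (m + 1) * growth S s) :
    IsPackingBound d G m := by
  intro L hL
  obtain ⟨l, hl⟩ := exists_subset_wordBall hS hL
  obtain ⟨s, hs⟩ := h l
  refine ⟨wordBall S (2 * s), wordBall_finite hSf _, ?_, one_mem_wordBall _, fun n hn g hg => ?_⟩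
  · ext x
    rw [Set.mem_inv]
    exact ⟨fun hx => by simpa using wordBall_inv_mem hx, wordBall_inv_mem⟩
  · refine exists_finset_of_growth_lt hSf (l := l)
      (hs.trans_le (Nat.mul_le_mul_right _ hn)) fun i => ?_
    obtain ⟨a, ha, b, hb, hab⟩ := hg i
    rw [← hab]
    exact wordBall_mul_mem ha (hl hb)

theorem finite_of_growth_le (hSf : S.Finite) (hS : Subgroup.closure S = ⊤) {B : ℕ}
    (h : ∀ n, growth S n ≤ B) : Finite G := by
  by_contra hinf
  rw [not_finite_iff_infinite] at hinf
  obtain ⟨F, hF⟩ := Infinite.exists_subset_card_eq G (B + 1)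
  obtain ⟨n, hn⟩ := exists_subset_wordBall hS F.finite_toSet
  have := (Set.ncard_le_ncard hn (wordBall_finite hSf n)).trans (h n)
  rw [Set.ncard_coe_finset, hF] at this
  omega

theorem LSP_le_of_growth_bounds (hSf : S.Finite) (hS : Subgroup.closure S = ⊤) {k : ℕ} {C D : ℝ}
    (hC : 0 < C) (hCD : C ≤ D)
    (h : ∀ n : ℕ, C * (n : ℝ) ^ k ≤ growth S n ∧ (growth S n : ℝ) ≤ D * (n : ℝ) ^ k + 1) (d : ℕ) :
    (LSP d G : ℝ≥0∞) ≤ ENNReal.ofReal (3 ^ k * (d + 1) * (D / C)) := by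
  suffices ∃ m : ℕ, IsPackingBound d G m ∧ (m : ℝ) ≤ 3 ^ k * (d + 1) * (D / C) by
    obtain ⟨m, hm, hle⟩ := this
    calc (LSP d G : ℝ≥0∞) ≤ ((m : ℕ∞) : ℝ≥0∞) :=
          ENat.toENNReal_le.2 (LSP_le_of_isPackingBound hm)
      _ = ENNReal.ofReal m := by simp
      _ ≤ _ := ENNReal.ofReal_le_ofReal hle
  have hDC : 1 ≤ D / C := (one_le_div hC).2 hCD
  -- For `k = 0` the summand 1 in the upper bound would survive in the limit; but then growth is
  -- bounded and `G` is finite.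
  rcases Nat.eq_zero_or_pos k with rfl | hk
  · have : Finite G := finite_of_growth_le hSf hS (B := ⌈D + 1⌉₊) fun n => by
      have := (h n).2.trans (Nat.le_ceil _)
      rw [pow_zero, mul_one] at this
      exact_mod_cast this
    refine ⟨d + 1, isPackingBound_of_finite d, ?_⟩
    rw [pow_zero, one_mul]
    push_cast
    exact le_mul_of_one_le_right (by positivity) hDC
  · have hX : 0 ≤ 3 ^ k * ((d : ℝ) + 1) * (D / C) := by positivity
    refine ⟨⌊3 ^ k * ((d : ℝ) + 1) * (D / C)⌋₊, isPackingBound_of_growth hSf hS fun l => ?_,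
      Nat.floor_le hX⟩
    set m := ⌊3 ^ k * ((d : ℝ) + 1) * (D / C)⌋₊ with hm
    have hlim : Filter.Tendsto (fun s : ℕ => ((d : ℝ) + 1) *
        (D * (3 + (l : ℝ) / s) ^ k + (1 / (s : ℝ)) ^ k)) Filter.atTop
        (nhds (((d : ℝ) + 1) * (D * (3 + 0) ^ k + 0 ^ k))) :=
      (((tendsto_const_nhds.add (tendsto_const_div_atTop_nhds_zero_nat _)).pow k).const_mul D |>.add
        ((tendsto_const_div_atTop_nhds_zero_nat _).pow k)).const_mul _
    -- Strictness comes from the floor: `m + 1` exceeds `3^k (d+1) D/C`.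
    have hlt : ((d : ℝ) + 1) * (D * (3 + 0) ^ k + 0 ^ k) < (m + 1) * C := by
      rw [zero_pow hk.ne', add_zero, add_zero, ← div_lt_iff₀ hC]
      refine lt_of_eq_of_lt ?_ (Nat.lt_floor_add_one (3 ^ k * ((d : ℝ) + 1) * (D / C)))
      ring
    obtain ⟨s, hs, hs1⟩ :=
      ((hlim.eventually_lt_const hlt).and (Filter.eventually_ge_atTop 1)).exists
    refine ⟨s, ?_⟩
    have hs0 : (0 : ℝ) < s := by exact_mod_cast hs1
    have hsk : (0 : ℝ) < (s : ℝ) ^ k := pow_pos hs0 k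
    have e : (s : ℝ) ^ k * (D * (3 + (l : ℝ) / s) ^ k + (1 / (s : ℝ)) ^ k) =
        D * ((3 * s + l : ℕ) : ℝ) ^ k + 1 := by
      rw [mul_add, mul_left_comm, ← mul_pow, ← mul_pow, mul_one_div_cancel hs0.ne', one_pow,
        mul_add, mul_div_cancel₀ _ hs0.ne']
      push_cast
      ring
    have key : ((d : ℝ) + 1) * growth S (3 * s + l) < (m + 1) * growth S s := by
      calc ((d : ℝ) + 1) * growth S (3 * s + l)
          ≤ ((d : ℝ) + 1) * (D * ((3 * s + l : ℕ) : ℝ) ^ k + 1) :=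
            mul_le_mul_of_nonneg_left (h _).2 (by positivity)
        _ = (s : ℝ) ^ k * (((d : ℝ) + 1) *
              (D * (3 + (l : ℝ) / s) ^ k + (1 / (s : ℝ)) ^ k)) := by rw [← e]; ring
        _ < (s : ℝ) ^ k * ((m + 1) * C) := mul_lt_mul_of_pos_left hs hsk
        _ = (m + 1) * (C * (s : ℝ) ^ k) := by ring
        _ ≤ (m + 1) * growth S s := mul_le_mul_of_nonneg_left (h s).1 (by positivity)
    exact_mod_cast key

end Packing

theorem mainTheorem6 (G : Type*) [Group G] [Group.FG G] (hG : Group.IsVirtuallyNilpotent G) :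
    (∀ d : ℕ, LSP d G < ⊤) ∧
    ∀ S : Set G, S.Finite → Subgroup.closure S = ⊤ →
      (∃ (k : ℕ) (C D : ℝ), 0 < C ∧ C ≤ D ∧
        ∀ n : ℕ, C * (n : ℝ) ^ k ≤ growth S n ∧ (growth S n : ℝ) ≤ D * (n : ℝ) ^ k + 1) ∧
      (∀ (k : ℕ) (C D : ℝ), 0 < C → C ≤ D →
        (∀ n : ℕ, C * (n : ℝ) ^ k ≤ growth S n ∧ (growth S n : ℝ) ≤ D * (n : ℝ) ^ k + 1) →
        ∀ d : ℕ, (LSP d G : ℝ≥0∞) ≤ ENNReal.ofReal (3 ^ k * (d + 1) * (D / C))) := by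
  have growth_bounds : ∀ S : Set G, S.Finite → Subgroup.closure S = ⊤ →
      ∃ (k : ℕ) (C D : ℝ), 0 < C ∧ C ≤ D ∧
        ∀ n : ℕ, C * (n : ℝ) ^ k ≤ growth S n ∧ (growth S n : ℝ) ≤ D * (n : ℝ) ^ k + 1 := by
    intro S hSf hS
    obtain ⟨k, D, K, h⟩ := exists_growth_bounds_of_isVirtuallyNilpotent hG hSf hS
    exact ⟨k, exists_real_growth_bounds hSf h⟩
  refine ⟨fun d => ?_, fun S hSf hS => ⟨growth_bounds S hSf hS, fun k C D hC hCD h d =>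
    LSP_le_of_growth_bounds hSf hS hC hCD h d⟩⟩
  obtain ⟨S, hS⟩ := (inferInstance : Group.FG G).1
  obtain ⟨k, C, D, hC, hCD, h⟩ := growth_bounds S S.finite_toSet hS
  have := (LSP_le_of_growth_bounds S.finite_toSet hS hC hCD h d).trans_lt ENNReal.ofReal_lt_top
  exact ENat.toENNReal_lt_top.1 this
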